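/- Let $n\ge 1$ and let $M$ be a $(2n+1)$-dimensional Kenmotsu manifold: a smooth manifold with a Riemannian metric $g$, a $(1,1)$-tensor field $\phi$, a vector field $\xi$ and a $1$-form $\eta$ (all smooth) such that $\phi^2=-I+\eta\otimes\xi$, $\eta(\xi)=1$, $g(\phi X,\phi Y)=g(X,Y)-\eta(X)\eta(Y)$ and $\nabla_X\xi=X-\eta(X)\xi$ for all vector fields $X,Y$, where $\nabla$ is the Levi-Civita connection of $g$. Let $\tilde\nabla$ be the connection $$\tilde\nabla_XY=\nabla_XY-\eta(Y)X-g(X,Y)\xi .$$ Let $R(X,Y)Z=\nabla_X\nabla_YZ-\nabla_Y\nabla_XZ-\nabla_{[X,Y]}Z$ and $S(Y,Z)=\operatorname{tr}(X\mapsto R(X,Y)Z)$ be the curvature and Ricci tensors of $\nabla$, and let $\tilde R,\tilde S$ be those of $\tilde\nabla$, defined by the same formulas. For a $(1,3)$-tensor $B$ and a $(0,k)$-tensor $T$ put $$(B\cdot T)(X_1,\dots,X_k;X,Y)=-\sum_{i=1}^kT(X_1,\dots,B(X,Y)X_i,\dots,X_k),$$ and let $Q(g,T)$ be the Tachibana tensor,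 that is, $B\cdot T$ for $B(X,Y)Z=(X\wedge_gY)Z=g(Y,Z)X-g(X,Z)Y$. Let $C$ be the conformal curvature tensor $$C(X,Y)Z=R(X,Y)Z-\tfrac1{N-2}\bigl(S(Y,Z)X-S(X,Z)Y+g(Y,Z)\mathcal QX-g(X,Z)\mathcal QY\bigr)+\tfrac r{(N-1)(N-2)}\bigl(g(Y,Z)X-g(X,Z)Y\bigr),$$ where $N=2n+1$, $g(\mathcal QX,Y)=S(X,Y)$ and $r=\operatorname{tr}\mathcal Q$. Where $R$ and $C$ stand in the place of $T$, they denote the $(0,4)$-tensors $g(R(X_1,X_2)X_3,X_4)$ and $g(C(X_1,X_2)X_3,X_4)$. If $\tilde R\cdot\tilde S=R\cdot S$ on $M$, then on $M$ $$C\cdot R-R\cdot C=Q(g,R)=Q(g,C).$$ -/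

import Mathlib

open Bundle VectorField Module
open scoped Manifold ContDiff

noncomputable section

namespace KenmotsuGeometry

/-! ### Tensors on one finite-dimensional vector space with a scalar product `g`

Tensors are written as functions of their vector arguments. -/

section Algebra

variable {V : Type*} [AddCommGroup V] [Module ℝ V]

/-- The endomorphism `(X ∧_g Y) Z = g(Y, Z) X - g(X, Z) Y`. -/
def wedge (g : V → V → ℝ) (X Y Z : V) : V := g Y Z • X - g X Z • Y

/-- The `(0,4)`-form `(X₁, X₂, X₃, X₄) ↦ g(B(X₁, X₂)X₃, X₄)` of a `(1,3)`-tensor `B`. -/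
def lower (g : V → V → ℝ) (B : V → V → V → V) (X₁ X₂ X₃ X₄ : V) : ℝ := g (B X₁ X₂ X₃) X₄

/-- `(B(X, Y) · T)(Z, U) = - T(B(X, Y)Z, U) - T(Z, B(X, Y)U)`, for a `(1,3)`-tensor `B` and a
`(0,2)`-tensor `T`. -/
def dotTwo (B : V → V → V → V) (T : V → V → ℝ) (Z U X Y : V) : ℝ :=
  - T (B X Y Z) U - T Z (B X Y U)

/-- `(B · T)(X₁, X₂, X₃, X₄; X, Y) = (B(X, Y) · T)(X₁, X₂, X₃, X₄)`, for a `(1,3)`-tensor `B` and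
a `(0,4)`-tensor `T`, where `B(X, Y)` acts on `T` as a derivation. -/
def dotFour (B : V → V → V → V) (T : V → V → V → V → ℝ) (X₁ X₂ X₃ X₄ X Y : V) : ℝ :=
  - T (B X Y X₁) X₂ X₃ X₄ - T X₁ (B X Y X₂) X₃ X₄ - T X₁ X₂ (B X Y X₃) X₄
    - T X₁ X₂ X₃ (B X Y X₄)

/-- The Tachibana tensor `Q(g, T)(X₁, X₂, X₃, X₄; X, Y) = ((X ∧_g Y) · T)(X₁, X₂, X₃, X₄)` of a
`(0,4)`-tensor `T`. -/
def tachibana (g : V → V → ℝ) (T : V → V → V → V → ℝ) : V → V → V → V → V → V → ℝ :=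
  dotFour (wedge g) T

variable [FiniteDimensional ℝ V]

/-- The trace of a linear endomorphism, see `contraction_eq_trace`. -/
def contraction (f : V → V) : ℝ := ∑ i, (finBasis ℝ V).repr (f (finBasis ℝ V i)) i

theorem contraction_eq_trace (f : V →ₗ[ℝ] V) : contraction f = LinearMap.trace ℝ V f := by
  rw [LinearMap.trace_eq_matrix_trace ℝ (finBasis ℝ V)]
  simp [contraction, Matrix.trace, LinearMap.toMatrix_apply]

/-- The Ricci tensor `S(Y, Z) = tr (X ↦ R(X, Y)Z)` of a `(1,3)`-tensor `R`. -/
def ricci (R : V → V → V → V) (Y Z : V) : ℝ := contraction fun X ↦ R X Y Z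

/-- The entries `g^{ij}` of the inverse of the Gram matrix of `g` in a basis `(bᵢ)` of `V`. -/
def inverseMetric (g : V → V → ℝ) : Matrix (Fin (finrank ℝ V)) (Fin (finrank ℝ V)) ℝ :=
  (Matrix.of fun i j ↦ g (finBasis ℝ V i) (finBasis ℝ V j))⁻¹

/-- The operator `Q` with `g(QX, Y) = S(X, Y)`, that is `QX = ∑ g^{ij} S(X, bᵢ) bⱼ`. -/
def raise (g S : V → V → ℝ) (X : V) : V :=
  ∑ i, ∑ j, (inverseMetric g i j * S X (finBasis ℝ V i)) • finBasis ℝ V j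

/-- The metric trace `∑ g^{ij} S(bᵢ, bⱼ)` of a `(0,2)`-tensor. -/
def metricTrace (g S : V → V → ℝ) : ℝ :=
  ∑ i, ∑ j, inverseMetric g i j * S (finBasis ℝ V i) (finBasis ℝ V j)

/-- The conformal (Weyl) curvature tensor of a curvature tensor `R` in dimension `N`, with `S`,
`Q`, `r` the Ricci tensor, Ricci operator and scalar curvature:
`C(X,Y)Z = R(X,Y)Z - (1/(N-2)) (S(Y,Z)X - S(X,Z)Y + g(Y,Z)QX - g(X,Z)QY)
  + (r/((N-1)(N-2))) (g(Y,Z)X - g(X,Z)Y)`. -/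
def conformal (g : V → V → ℝ) (R : V → V → V → V) (X Y Z : V) : V :=
  R X Y Z
    - (1 / ((finrank ℝ V : ℝ) - 2)) •
        (ricci R Y Z • X - ricci R X Z • Y
          + g Y Z • raise g (ricci R) X - g X Z • raise g (ricci R) Y)
    + (metricTrace g (ricci R) / (((finrank ℝ V : ℝ) - 1) * ((finrank ℝ V : ℝ) - 2))) •
        (g Y Z • X - g X Z • Y)

end Algebra

/-! ### Connections, curvature and Kenmotsu manifolds -/

section Geometry

variable {E : Type*} [NormedAddCommGroup E] [NormedSpace ℝ E]
  {H : Type*} [TopologicalSpace H] {I : ModelWithCorners ℝ E H}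
  {M : Type*} [TopologicalSpace M] [ChartedSpace H M]

instance finiteDimensional_tangentSpace [FiniteDimensional ℝ E] (x : M) :
    FiniteDimensional ℝ (TangentSpace I x) :=
  inferInstanceAs (FiniteDimensional ℝ E)

variable [IsManifold I ∞ M]

/-- `R(X, Y)Z = ∇_X ∇_Y Z - ∇_Y ∇_X Z - ∇_{[X, Y]} Z` for vector fields `X`, `Y`, `Z`
(here `cov Z x (X x)` is the value of `∇_X Z` at `x`). -/
def curvatureOfFields (cov : CovariantDerivative I E (TangentSpace I : M → Type _))
    (X Y Z : Π x : M, TangentSpace I x) (x : M) : TangentSpace I x :=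
  cov (fun y ↦ cov Z y (Y y)) x (X x) - cov (fun y ↦ cov Z y (X y)) x (Y x)
    - cov Z x (mlieBracket I X Y x)

/-- The curvature tensor of an affine connection at the point `x`: `R(u, v)w` is computed with
vector fields that extend the tangent vectors `u`, `v`, `w` and are smooth near `x`; for a smooth
connection the value does not depend on the extensions. -/
def curvature (cov : CovariantDerivative I E (TangentSpace I : M → Type _)) (x : M)
    (u v w : TangentSpace I x) : TangentSpace I x :=
  curvatureOfFields cov (FiberBundle.extend E u) (FiberBundle.extend E v)
    (FiberBundle.extend E w) x

/-- `g` at the point `x`, as a function of two tangent vectors. -/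
def metricAt (g : ContMDiffRiemannianMetric I ∞ E (TangentSpace I : M → Type _)) (x : M)
    (u v : TangentSpace I x) : ℝ := g.inner x u v

/-- The conformal curvature tensor `C` of `g` at the point `x`, where `cov` is the Levi-Civita
connection of `g`. -/
def conformalCurvature [FiniteDimensional ℝ E]
    (g : ContMDiffRiemannianMetric I ∞ E (TangentSpace I : M → Type _))
    (cov : CovariantDerivative I E (TangentSpace I : M → Type _)) (x : M) :
    TangentSpace I x → TangentSpace I x → TangentSpace I x → TangentSpace I x :=
  conformal (metricAt g x) (curvature cov x)

/-- `cov` is the Levi-Civita connection of `g`: the smooth torsion-free connection with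
`X(g(Y, Z)) = g(∇_X Y, Z) + g(Y, ∇_X Z)`. -/
structure IsLeviCivita [FiniteDimensional ℝ E]
    (g : ContMDiffRiemannianMetric I ∞ E (TangentSpace I : M → Type _))
    (cov : CovariantDerivative I E (TangentSpace I : M → Type _)) : Prop where
  smooth : CovariantDerivative.ContMDiffCovariantDerivative cov ∞
  torsion_eq_zero : cov.torsion = 0
  metric : ∀ (x : M) (X : TangentSpace I x) (Y Z : Π y : M, TangentSpace I y),
    MDiffAt (T% Y) x → MDiffAt (T% Z) x →
    d% (fun y ↦ g.inner y (Y y) (Z y)) x X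
      = g.inner x (cov Y x X) (Z x) + g.inner x (Y x) (cov Z x X)

/-- An almost contact metric structure `(φ, ξ, η)` on `M`, compatible with the metric `g`:
smooth tensor fields with `φ² = -I + η ⊗ ξ`, `η(ξ) = 1` and
`g(φX, φY) = g(X, Y) - η(X)η(Y)`. -/
structure AlmostContactMetricStructure
    (g : ContMDiffRiemannianMetric I ∞ E (TangentSpace I : M → Type _)) where
  φ : Π x : M, TangentSpace I x →L[ℝ] TangentSpace I x
  ξ : Π x : M, TangentSpace I x
  η : Π x : M, TangentSpace I x →L[ℝ] ℝ
  smooth_φ : ContMDiff I (I.prod 𝓘(ℝ, E →L[ℝ] E)) ∞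
    (fun x ↦ TotalSpace.mk' (E →L[ℝ] E)
      (E := fun x : M ↦ TangentSpace I x →L[ℝ] TangentSpace I x) x (φ x))
  smooth_ξ : ContMDiff I (I.prod 𝓘(ℝ, E)) ∞
    (fun x ↦ TotalSpace.mk' E (E := fun x : M ↦ TangentSpace I x) x (ξ x))
  smooth_η : ContMDiff I (I.prod 𝓘(ℝ, E →L[ℝ] ℝ)) ∞
    (fun x ↦ TotalSpace.mk' (E →L[ℝ] ℝ)
      (E := fun x : M ↦ TangentSpace I x →L[ℝ] Bundle.Trivial M ℝ x) x (η x))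
  φ_sq : ∀ x (X : TangentSpace I x), φ x (φ x X) = -X + η x X • ξ x
  η_ξ : ∀ x, η x (ξ x) = 1
  compatible : ∀ x (X Y : TangentSpace I x),
    g.inner x (φ x X) (φ x Y) = g.inner x X Y - η x X * η x Y

/-- The almost contact metric manifold, with Levi-Civita connection `cov`, is a Kenmotsu manifold:
`∇_X ξ = X - η(X) ξ`. -/
def IsKenmotsu {g : ContMDiffRiemannianMetric I ∞ E (TangentSpace I : M → Type _)}
    (s : AlmostContactMetricStructure g)
    (cov : CovariantDerivative I E (TangentSpace I : M → Type _)) : Prop :=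
  ∀ x (X : TangentSpace I x), cov s.ξ x X = X - s.η x X • s.ξ x

/-- The non-symmetric non-metric connection `∇̃_X Y = ∇_X Y - η(Y) X - g(X, Y) ξ`. -/
def tildeConnection {g : ContMDiffRiemannianMetric I ∞ E (TangentSpace I : M → Type _)}
    (s : AlmostContactMetricStructure g)
    (cov : CovariantDerivative I E (TangentSpace I : M → Type _)) :
    CovariantDerivative I E (TangentSpace I : M → Type _) where
  toFun Y x := cov Y x - s.η x (Y x) • ContinuousLinearMap.id ℝ (TangentSpace I x)
    - (g.inner x (Y x)).smulRight (s.ξ x)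
  isCovariantDerivativeOnUniv :=
    { add := by
        intro Y Y' x hY hY' _
        rw [cov.isCovariantDerivativeOnUniv.add hY hY']
        ext X
        simp [add_smul]
        abel
      leibniz := by
        intro Y f x hY hf _
        rw [cov.isCovariantDerivativeOnUniv.leibniz hY hf]
        ext X
        simp [smul_sub, mul_smul]
        abel }

theorem tildeConnection_apply {g : ContMDiffRiemannianMetric I ∞ E (TangentSpace I : M → Type _)}
    (s : AlmostContactMetricStructure g)
    (cov : CovariantDerivative I E (TangentSpace I : M → Type _))
    (Y : Π x : M, TangentSpace I x) (x : M) (X : TangentSpace I x) :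
    tildeConnection s cov Y x X = cov Y x X - s.η x (Y x) • X - g.inner x X (Y x) • s.ξ x := by
  simp [tildeConnection, g.symm x X (Y x)]

end Geometry

end KenmotsuGeometry

end

open KenmotsuGeometry

/-! The hypothesis forces $M$ to be Einstein, and the rest is algebra at one point. Write $N=2n+1$.
On a Kenmotsu manifold $R(X,Y)\xi=\eta(X)Y-\eta(Y)X$, and differentiating $\tilde\nabla$ gives
$\tilde R(X,Y)Z=R(X,Y)Z+(X\wedge_gY)Z+2(g(Y,Z)\eta(X)-g(X,Z)\eta(Y))\xi$ (`curvature_ξ`,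
`curvature_tildeConnection`). Hence $\tilde R(\xi,Y)\xi=0$ and $\tilde S(\xi,\cdot)=0$, so $\tilde
R\cdot\tilde S$ vanishes at $(\xi,Z;\xi,Y)$. The same component of $R\cdot S$ is
$-S(Y,Z)-(N-1)g(Y,Z)$, so $S=-(N-1)g$ (`ricci_eq_of_dotTwo_eq`).

For this Ricci tensor $C=R+\wedge_g$ (`conformal_eq_add_wedge`). In $C\cdot R-R\cdot C$ the terms
$R\cdot R$ cancel, leaving $Q(g,R)-R\cdot\wedge_g$. Skew endomorphisms annihilate $g$, hence also
the lowering of $\wedge_g$ (`dotFour_lower_wedge`), which gives both equalities.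

The analytic half shows that the pointwise `curvature` has the Riemannian symmetries. It replaces
the local extensions of tangent vectors by global smooth fields, for which the identities are
proved. -/

namespace KenmotsuGeometry

/-! ### Traces of endomorphisms. -/

section Contraction

variable {V : Type*} [AddCommGroup V] [Module ℝ V] [FiniteDimensional ℝ V]

theorem contraction_add (f h : V → V) :
    contraction (fun X ↦ f X + h X) = contraction f + contraction h := by
  simp [contraction, Finset.sum_add_distrib]

theorem contraction_sub (f h : V → V) :
    contraction (fun X ↦ f X - h X) = contraction f - contraction h := by
  simp [contraction, Finset.sum_sub_distrib]

theorem contraction_const_smul (c : ℝ) (f : V → V) :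
    contraction (fun X ↦ c • f X) = c * contraction f := by
  simp [contraction, Finset.mul_sum]

theorem contraction_id : contraction (fun X : V ↦ X) = finrank ℝ V := by
  simp [contraction]

theorem contraction_smul_const (a : V →ₗ[ℝ] ℝ) (v : V) :
    contraction (fun X ↦ a X • v) = a v := by
  conv_rhs => rw [← (finBasis ℝ V).sum_repr v, map_sum]
  simp [contraction, mul_comm]

end Contraction

/-! ### Raising an index and metric trace for multiples of $g$. -/

section Metric

variable {V : Type*} [AddCommGroup V] [Module ℝ V] {g : V →ₗ[ℝ] V →ₗ[ℝ] ℝ}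

theorem eq_of_forall_metric_eq (g_pos : ∀ X, X ≠ 0 → 0 < g X X) {X Y : V}
    (h : ∀ Z, g X Z = g Y Z) : X = Y := by
  by_contra hXY
  have h_pos := g_pos (X - Y) (sub_ne_zero.2 hXY)
  simp [h] at h_pos

variable [FiniteDimensional ℝ V]

/-- A positive definite Gram matrix is invertible. -/
theorem inverseMetric_mul_gram (g_pos : ∀ X, X ≠ 0 → 0 < g X X) :
    inverseMetric (fun X Y ↦ g X Y) *
      (Matrix.of fun i j ↦ g (finBasis ℝ V i) (finBasis ℝ V j)) = 1 := by
  set b := finBasis ℝ V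
  set G := Matrix.of fun i j ↦ g (b i) (b j)
  apply Matrix.nonsing_inv_mul
  rw [← Matrix.isUnit_iff_isUnit_det, ← Matrix.vecMul_injective_iff_isUnit]
  change Function.Injective (Matrix.vecMulLinear G)
  rw [injective_iff_map_eq_zero]
  intro c hc
  -- A row vector in the kernel of the Gram matrix is the coordinate vector of some $v$ orthogonal
  -- to the whole basis.
  set v := ∑ i, c i • b i with hv
  have hvb : ∀ j, g v (b j) = 0 := fun j ↦ by
    simpa [hv, Matrix.vecMulLinear, Matrix.vecMul, dotProduct, G] using congrFun hc j
  have hgv : g v = 0 := b.ext fun j ↦ by simpa using hvb j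
  have hv0 : v = 0 := eq_of_forall_metric_eq g_pos fun Z ↦ by simp [hgv]
  exact funext (Fintype.linearIndependent_iff.1 b.linearIndependent c hv0)

theorem raise_const_mul_metric (g_pos : ∀ X, X ≠ 0 → 0 < g X X) (c : ℝ) (X : V) :
    raise (fun X Y ↦ g X Y) (fun X Y ↦ c * g X Y) X = c • X := by
  set b := finBasis ℝ V with hb
  set A := inverseMetric (fun X Y : V ↦ g X Y) with hA
  have hAG := inverseMetric_mul_gram g_pos
  have hGA := mul_eq_one_comm.1 hAG
  rw [← hA] at hGA
  have key : ∀ k j, ∑ i, A i j * g (b k) (b i) = if k = j then 1 else 0 := fun k j ↦ by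
    have := congrFun (congrFun hGA k) j
    rw [Matrix.mul_apply, Matrix.one_apply] at this
    rw [← this]
    exact Finset.sum_congr rfl fun i _ ↦ by simp [mul_comm, hb]
  have h_basis : ∀ k, ∑ j, ∑ i, (A i j * g (b k) (b i)) • b j = b k := fun k ↦ by
    simp [← Finset.sum_smul, key]
  have h_lin : ∀ X, (∑ j, ∑ i, (A i j * g X (b i)) • b j) = X := by
    intro X
    let F : V →ₗ[ℝ] V := ∑ j, ∑ i, (A i j • g.flip (b i)).smulRight (b j)
    have hF : F = LinearMap.id := b.ext fun k ↦ by
      simpa [F] using h_basis k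
    simpa [F] using LinearMap.congr_fun hF X
  rw [raise, Finset.sum_comm, ← hA, ← hb]
  conv_rhs => rw [← h_lin X]
  simp only [Finset.smul_sum, smul_smul]
  exact Finset.sum_congr rfl fun j _ ↦ Finset.sum_congr rfl fun i _ ↦ by ring_nf

theorem metricTrace_const_mul_metric (g_symm : ∀ X Y, g X Y = g Y X)
    (g_pos : ∀ X, X ≠ 0 → 0 < g X X) (c : ℝ) :
    metricTrace (fun X Y ↦ g X Y) (fun X Y ↦ c * g X Y) = c * finrank ℝ V := by
  have h := congrArg Matrix.trace (inverseMetric_mul_gram g_pos)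
  rw [Matrix.trace_one, Fintype.card_fin] at h
  rw [← h, metricTrace, Matrix.trace, Finset.mul_sum]
  refine Finset.sum_congr rfl fun i _ ↦ ?_
  rw [Matrix.diag_apply, Matrix.mul_apply, Finset.mul_sum]
  refine Finset.sum_congr rfl fun j _ ↦ ?_
  rw [Matrix.of_apply, g_symm]
  ring

end Metric

/-! ### Algebraic curvature tensors. -/

/-- The algebraic properties of the curvature tensor of a Riemannian metric at one point. -/
structure IsCurvatureLike {V : Type*} [AddCommGroup V] [Module ℝ V] (g : V →ₗ[ℝ] V →ₗ[ℝ] ℝ)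
    (R : V → V → V → V) : Prop where
  add_mid : ∀ X Y Y' Z, R X (Y + Y') Z = R X Y Z + R X Y' Z
  smul_mid : ∀ (c : ℝ) X Y Z, R X (c • Y) Z = c • R X Y Z
  add_right : ∀ X Y Z Z', R X Y (Z + Z') = R X Y Z + R X Y Z'
  antisymm : ∀ X Y Z, R X Y Z = - R Y X Z
  skew : ∀ X Y Z W, g (R X Y Z) W = - g Z (R X Y W)
  bianchi : ∀ X Y Z, R X Y Z + R Y Z X + R Z X Y = 0

namespace IsCurvatureLike

variable {V : Type*} [AddCommGroup V] [Module ℝ V] {g : V →ₗ[ℝ] V →ₗ[ℝ] ℝ}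
  {R : V → V → V → V}

theorem add_left (hR : IsCurvatureLike g R) (X X' Y Z : V) :
    R (X + X') Y Z = R X Y Z + R X' Y Z := by
  rw [hR.antisymm, hR.add_mid, hR.antisymm X Y, hR.antisymm X' Y]
  abel

/-- Octahedron argument: take the Bianchi identities for the four cyclic rotations of $(X,Y,Z,W)$
with signs $+,+,-,-$; the antisymmetries `a` and `s` cancel everything except the two terms wanted.
-/
theorem pair_symm (hR : IsCurvatureLike g R) (g_symm : ∀ X Y, g X Y = g Y X) (X Y Z W : V) :
    g (R X Y Z) W = g (R Z W X) Y := by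
  have a : ∀ A B C D, g (R A B C) D = - g (R B A C) D := fun A B C D ↦ by
    rw [hR.antisymm A B, map_neg, LinearMap.neg_apply]
  have s : ∀ A B C D, g (R A B C) D = - g (R A B D) C := fun A B C D ↦ by
    rw [hR.skew, g_symm]
  have c : ∀ A B C D, g (R A B C) D + g (R B C A) D + g (R C A B) D = 0 := fun A B C D ↦ by
    simpa using congrArg (fun v ↦ g v D) (hR.bianchi A B C)
  linarith [c X Y Z W, c Y Z W X, c Z W X Y, c W X Y Z, s X Y Z W, s Y Z W X, s Z W X Y,
    s W X Y Z, s Y Z X W, s Z X Y W, s Z W Y X, s W Y Z X, s W X Z Y, s X Z W Y, s X Y W Z,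
    s Y W X Z, a X Z W Y, a Y W X Z, a Z X Y W, a W Y Z X, a X Z Y W, a Z X W Y]

end IsCurvatureLike

/-! ### The pointwise argument: Einstein condition and conformal tensor. -/

section Kenmotsu

variable {V : Type*} [AddCommGroup V] [Module ℝ V]
  {g : V →ₗ[ℝ] V →ₗ[ℝ] ℝ} {R R' : V → V → V → V} {ξ : V}

/-- Pair symmetry moves $\xi$ from the first slot to the third, where `hRξ` applies. -/
theorem curvature_reeb_left (hR : IsCurvatureLike g R) (g_symm : ∀ X Y, g X Y = g Y X)
    (g_pos : ∀ X, X ≠ 0 → 0 < g X X)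
    (hRξ : ∀ X Y, R X Y ξ = g X ξ • Y - g Y ξ • X) (Y Z : V) :
    R ξ Y Z = g Z ξ • Y - g Y Z • ξ := by
  refine eq_of_forall_metric_eq g_pos fun W ↦ ?_
  rw [hR.pair_symm g_symm, hRξ]
  simp only [map_sub, map_smul, LinearMap.sub_apply, LinearMap.smul_apply, smul_eq_mul]
  rw [g_symm W Y, g_symm ξ W, g_symm Z Y]
  ring

/-- A `(1,3)`-tensor with values in the skew endomorphisms annihilates the lowering of `∧_g`. -/
theorem dotFour_lower_wedge {B : V → V → V → V} (hB : ∀ X Y Z W, g (B X Y Z) W = - g Z (B X Y W))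
    (X₁ X₂ X₃ X₄ X Y : V) :
    dotFour B (lower (fun X Y ↦ g X Y) (wedge fun X Y ↦ g X Y)) X₁ X₂ X₃ X₄ X Y = 0 := by
  -- The lowered $\wedge_g$ is a polynomial in $g$; moving $B(X,Y)$ across each factor by skewness
  -- makes the terms cancel in pairs.
  simp only [dotFour, lower, wedge, map_sub, map_smul, LinearMap.sub_apply, LinearMap.smul_apply,
    smul_eq_mul, hB]
  ring

theorem wedge_skew (g_symm : ∀ X Y, g X Y = g Y X) (X Y Z W : V) :
    g (wedge (fun X Y ↦ g X Y) X Y Z) W = - g Z (wedge (fun X Y ↦ g X Y) X Y W) := by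
  simp only [wedge, map_sub, map_smul, LinearMap.sub_apply, LinearMap.smul_apply, smul_eq_mul]
  rw [g_symm Z X, g_symm Z Y]
  ring

theorem dotFour_lower_add (B R₁ R₂ : V → V → V → V) (X₁ X₂ X₃ X₄ X Y : V) :
    dotFour B (lower (fun X Y ↦ g X Y) fun X Y Z ↦ R₁ X Y Z + R₂ X Y Z) X₁ X₂ X₃ X₄ X Y
      = dotFour B (lower (fun X Y ↦ g X Y) R₁) X₁ X₂ X₃ X₄ X Y
        + dotFour B (lower (fun X Y ↦ g X Y) R₂) X₁ X₂ X₃ X₄ X Y := by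
  simp only [dotFour, lower, map_add, LinearMap.add_apply]
  ring

theorem IsCurvatureLike.dotFour_add_lower (hR : IsCurvatureLike g R) (B₁ B₂ : V → V → V → V)
    (X₁ X₂ X₃ X₄ X Y : V) :
    dotFour (fun X Y Z ↦ B₁ X Y Z + B₂ X Y Z) (lower (fun X Y ↦ g X Y) R) X₁ X₂ X₃ X₄ X Y
      = dotFour B₁ (lower (fun X Y ↦ g X Y) R) X₁ X₂ X₃ X₄ X Y
        + dotFour B₂ (lower (fun X Y ↦ g X Y) R) X₁ X₂ X₃ X₄ X Y := by
  simp only [dotFour, lower, hR.add_left, hR.add_mid, hR.add_right, map_add, LinearMap.add_apply]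
  ring

/-- If `C = R + ∧_g`, then `C · R - R · C = Q(g, R) = Q(g, C)`. -/
theorem dotFour_sub_dotFour_of_eq_add_wedge (hR : IsCurvatureLike g R)
    (g_symm : ∀ X Y, g X Y = g Y X) {C : V → V → V → V}
    (hC : ∀ X Y Z, C X Y Z = R X Y Z + wedge (fun X Y ↦ g X Y) X Y Z) :
    dotFour C (lower (fun X Y ↦ g X Y) R) - dotFour R (lower (fun X Y ↦ g X Y) C)
        = tachibana (fun X Y ↦ g X Y) (lower (fun X Y ↦ g X Y) R)
      ∧ tachibana (fun X Y ↦ g X Y) (lower (fun X Y ↦ g X Y) R)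
        = tachibana (fun X Y ↦ g X Y) (lower (fun X Y ↦ g X Y) C) := by
  obtain rfl : C = fun X Y Z ↦ R X Y Z + wedge (fun X Y ↦ g X Y) X Y Z :=
    funext fun X ↦ funext fun Y ↦ funext fun Z ↦ hC X Y Z
  constructor <;> funext X₁ X₂ X₃ X₄ X Y
  · simp only [Pi.sub_apply, tachibana]
    rw [hR.dotFour_add_lower, dotFour_lower_add, dotFour_lower_wedge hR.skew]
    ring
  · rw [tachibana, tachibana, dotFour_lower_add, dotFour_lower_wedge (wedge_skew g_symm), add_zero]

variable [FiniteDimensional ℝ V]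

theorem ricci_reeb_left (hR : IsCurvatureLike g R) (g_symm : ∀ X Y, g X Y = g Y X)
    (g_pos : ∀ X, X ≠ 0 → 0 < g X X)
    (hRξ : ∀ X Y, R X Y ξ = g X ξ • Y - g Y ξ • X) (Z : V) :
    ricci R ξ Z = - ((finrank ℝ V : ℝ) - 1) * g Z ξ := by
  have h : (fun X ↦ R X ξ Z) = fun X ↦ g.flip Z X • ξ - g Z ξ • X := by
    funext X
    rw [hR.antisymm, curvature_reeb_left hR g_symm g_pos hRξ, LinearMap.flip_apply]
    abel
  rw [ricci, h, contraction_sub, contraction_smul_const, contraction_const_smul, contraction_id,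
    LinearMap.flip_apply, g_symm ξ Z]
  ring

theorem IsCurvatureLike.ricci_add_left (hR : IsCurvatureLike g R) (Y Y' Z : V) :
    ricci R (Y + Y') Z = ricci R Y Z + ricci R Y' Z := by
  simp only [ricci, hR.add_mid, contraction_add]

theorem IsCurvatureLike.ricci_smul_left (hR : IsCurvatureLike g R) (c : ℝ) (Y Z : V) :
    ricci R (c • Y) Z = c * ricci R Y Z := by
  simp only [ricci, hR.smul_mid, contraction_const_smul]

/-- If `R' · S' = R · S`, where `R'` is the curvature of the non-metric connection of a Kenmotsu
manifold, then the manifold is Einstein. -/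
theorem ricci_eq_of_dotTwo_eq (hR : IsCurvatureLike g R) (g_symm : ∀ X Y, g X Y = g Y X)
    (g_pos : ∀ X, X ≠ 0 → 0 < g X X) (gξ : g ξ ξ = 1)
    (hRξ : ∀ X Y, R X Y ξ = g X ξ • Y - g Y ξ • X)
    (hR' : ∀ X Y Z, R' X Y Z = R X Y Z + wedge (fun X Y ↦ g X Y) X Y Z
      + (2 * (g Y Z * g X ξ - g X Z * g Y ξ)) • ξ)
    (h : dotTwo R' (ricci R') = dotTwo R (ricci R)) (Y Z : V) :
    ricci R Y Z = - ((finrank ℝ V : ℝ) - 1) * g Y Z := by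
  have hRic' : ∀ Y Z, ricci R' Y Z
      = ricci R Y Z + ((finrank ℝ V : ℝ) + 1) * g Y Z - 2 * (g Y ξ * g Z ξ) := by
    intro Y Z
    -- The added terms have traces $Ng(Y,Z)$, $-g(Y,Z)$, $2g(Y,Z)$ and $-2\eta(Y)\eta(Z)$.
    have hf : (fun X ↦ R' X Y Z) = fun X ↦
        R X Y Z + (g Y Z • X - g.flip Z X • Y)
          + ((2 * g Y Z) • (g.flip ξ X • ξ) - (2 * g Y ξ) • (g.flip Z X • ξ)) := by
      funext X
      simp only [hR', wedge, LinearMap.flip_apply]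
      module
    rw [ricci, hf]
    rw [contraction_add, contraction_add, contraction_sub, contraction_sub,
      contraction_const_smul, contraction_const_smul, contraction_const_smul,
      contraction_smul_const, contraction_smul_const, contraction_smul_const, contraction_id]
    simp only [LinearMap.flip_apply, gξ, g_symm ξ Z, ricci]
    ring
  have hL := ricci_reeb_left hR g_symm g_pos hRξ
  -- The coefficients of $\eta(Z)$ add up to $-(N-1)+(N+1)-2=0$.
  have hL' : ∀ Z, ricci R' ξ Z = 0 := fun Z ↦ by
    rw [hRic', hL, gξ, g_symm ξ Z]
    ring
  have h0 : ricci R' (R' ξ Y ξ) Z = 0 := by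
    -- Zero is written as a multiple of $\xi$ so that `hRic'` followed by homogeneity of the Ricci
    -- tensor of `R` finishes.
    have : R' ξ Y ξ = (0 : ℝ) • ξ := by
      rw [hR', curvature_reeb_left hR g_symm g_pos hRξ, wedge, gξ]
      module
    rw [this, hRic', hR.ricci_smul_left]
    simp
  -- At $(\xi,Z;\xi,Y)$ the left side vanishes; the right side needs only $S(\xi,\cdot)$ and
  -- linearity of $S$ in its first slot.
  have h1 := congrFun (congrFun (congrFun (congrFun h ξ) Z) ξ) Y
  simp only [dotTwo] at h1
  rw [h0, hL', hL, curvature_reeb_left hR g_symm g_pos hRξ,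
    curvature_reeb_left hR g_symm g_pos hRξ, gξ, one_smul, sub_eq_add_neg Y, ← neg_smul,
    hR.ricci_add_left, hR.ricci_smul_left, hL] at h1
  simp only [map_sub, map_smul, LinearMap.sub_apply, LinearMap.smul_apply, smul_eq_mul, gξ] at h1
  linarith

/-- On an Einstein space with `S = -(N - 1) g` the conformal curvature tensor is
`R(X, Y) + X ∧ Y`. -/
theorem conformal_eq_add_wedge (g_symm : ∀ X Y, g X Y = g Y X) (g_pos : ∀ X, X ≠ 0 → 0 < g X X)
    (hN : 2 < finrank ℝ V)
    (hS : ∀ Y Z, ricci R Y Z = - ((finrank ℝ V : ℝ) - 1) * g Y Z) (X Y Z : V) :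
    conformal (fun X Y ↦ g X Y) R X Y Z = R X Y Z + wedge (fun X Y ↦ g X Y) X Y Z := by
  have hS' : ricci R = fun Y Z ↦ - ((finrank ℝ V : ℝ) - 1) * g Y Z :=
    funext fun Y ↦ funext fun Z ↦ hS Y Z
  have hN2 : (2 : ℝ) < finrank ℝ V := by exact_mod_cast hN
  have h1 : (finrank ℝ V : ℝ) - 1 ≠ 0 := by linarith
  have h2 : (finrank ℝ V : ℝ) - 2 ≠ 0 := by linarith
  rw [conformal, hS', raise_const_mul_metric g_pos, raise_const_mul_metric g_pos,
    metricTrace_const_mul_metric g_symm g_pos, wedge]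
  generalize (finrank ℝ V : ℝ) = N at *
  -- Here $r=-N(N-1)$, so the coefficient of $\wedge_g$ is $\frac{2(N-1)}{N-2}-\frac{N}{N-2}=1$.
  match_scalars
  · field_simp
  · field_simp
    ring
  · field_simp
    ring

end Kenmotsu

/-! ### Smooth vector fields, global extensions and brackets. -/

section Fields

variable {E : Type*} [NormedAddCommGroup E] [NormedSpace ℝ E]
  {H : Type*} [TopologicalSpace H] {I : ModelWithCorners ℝ E H}
  {M : Type*} [TopologicalSpace M] [ChartedSpace H M] [IsManifold I ∞ M]

/-- The vector field `X` is smooth on all of `M`. -/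
def IsSmoothField (X : Π x : M, TangentSpace I x) : Prop := CMDiff ∞ (T% X)

/-- The covariant derivative of a smooth field along a smooth field is smooth. -/
def PreservesSmooth (cov : CovariantDerivative I E (TangentSpace I : M → Type _)) : Prop :=
  ∀ ⦃X Y : Π x : M, TangentSpace I x⦄, IsSmoothField X → IsSmoothField Y →
    IsSmoothField fun y ↦ cov Y y (X y)

variable {X Y Z W : Π x : M, TangentSpace I x} {f : M → ℝ} {x : M}

theorem IsSmoothField.mdifferentiableAt (hX : IsSmoothField X) (x : M) : MDiffAt (T% X) x :=
  ContMDiffAt.mdifferentiableAt (hX x) (by simp)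

theorem IsSmoothField.sub (hX : IsSmoothField X) (hY : IsSmoothField Y) : IsSmoothField (X - Y) :=
  ContMDiff.sub_section hX hY

theorem IsSmoothField.smul (hf : CMDiff ∞ f) (hX : IsSmoothField X) : IsSmoothField (f • X) :=
  ContMDiff.smul_section hf hX

theorem symmL_continuousLinearMapAt_eq_extend (u : TangentSpace I x) {y : M}
    (hy : y ∈ (trivializationAt E (TangentSpace I : M → Type _) x).baseSet) :
    (trivializationAt E (TangentSpace I : M → Type _) x).symmL ℝ y
      ((trivializationAt E (TangentSpace I : M → Type _) x).continuousLinearMapAt ℝ x u)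
        = FiberBundle.extend E u y := by
  have hx := mem_baseSet_trivializationAt E (TangentSpace I : M → Type _) x
  rw [FiberBundle.extend, Trivialization.symmL_apply _ hy,
    Trivialization.continuousLinearMapAt_apply, Trivialization.coe_linearMapAt_of_mem _ hx]

variable [FiniteDimensional ℝ E]

theorem IsSmoothField.mlieBracket (hX : IsSmoothField X) (hY : IsSmoothField Y) :
    IsSmoothField (mlieBracket I X Y) := by
  have : IsManifold I ((∞ : ℕ∞ω) + 1) M := by simpa using ‹IsManifold I ∞ M›
  have : IsManifold I (minSmoothness ℝ 2) M := by
    rw [minSmoothness_of_isRCLikeNormedField]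
    infer_instance
  exact ContDiff.mlieBracket_vectorField (n := ⊤) (m := ⊤) hX hY (by simp)

/-- A globally defined vector field that extends a tangent vector; it is smooth on Hausdorff
manifolds, and depends linearly on the tangent vector. -/
noncomputable def smoothExtend (u : TangentSpace I x) (y : M) : TangentSpace I y :=
  (Classical.arbitrary (SmoothBumpFunction I x)) y •
    (trivializationAt E (TangentSpace I : M → Type _) x).symmL ℝ y
      ((trivializationAt E (TangentSpace I : M → Type _) x).continuousLinearMapAt ℝ x u)

theorem smoothExtend_add (u v : TangentSpace I x) :
    smoothExtend (u + v) = smoothExtend u + smoothExtend v := by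
  funext y
  simp only [smoothExtend, map_add, smul_add, Pi.add_apply]

theorem smoothExtend_smul (c : ℝ) (u : TangentSpace I x) :
    smoothExtend (c • u) = c • smoothExtend u := by
  funext y
  simp only [smoothExtend, map_smul, Pi.smul_apply]
  exact smul_comm _ _ _

theorem smoothExtend_eventuallyEq (u : TangentSpace I x) :
    ∀ᶠ y in nhds x, smoothExtend u y = FiberBundle.extend E u y := by
  have hx := mem_baseSet_trivializationAt E (TangentSpace I : M → Type _) x
  filter_upwards [(Classical.arbitrary (SmoothBumpFunction I x)).eventuallyEq_one,
    (trivializationAt E (TangentSpace I : M → Type _) x).open_baseSet.mem_nhds hx] with y hy hy'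
  rw [smoothExtend, symmL_continuousLinearMapAt_eq_extend u hy', hy, Pi.one_apply, one_smul]

theorem smoothExtend_self (u : TangentSpace I x) : smoothExtend u x = u := by
  rw [(smoothExtend_eventuallyEq u).self_of_nhds, FiberBundle.extend_apply_self]

/-- The field is constant in the trivialization at `x`, and the Hausdorff property makes the bump
function, supported in the chart, smooth on all of `M`. -/
theorem isSmoothField_smoothExtend [T2Space M] (u : TangentSpace I x) :
    IsSmoothField (smoothExtend u) := by
  refine ContMDiffOn.smul_section_of_tsupport (u := (chartAt H x).source)
    (SmoothBumpFunction.contMDiff _).contMDiffOn (chartAt H x).open_source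
    (SmoothBumpFunction.tsupport_subset_chartAt_source _) ?_
  set t := trivializationAt E (TangentSpace I : M → Type _) x
  intro y hy
  have hy' : y ∈ t.baseSet := by simpa [t] using hy
  refine ContMDiffAt.contMDiffWithinAt ?_
  rw [t.contMDiffAt_section_iff hy']
  refine (contMDiffAt_const (c := t.continuousLinearMapAt ℝ x u)).congr_of_eventuallyEq ?_
  filter_upwards [t.open_baseSet.mem_nhds hy'] with z hz
  rw [t.symmL_apply hz, t.apply_mk_symm hz]

theorem IsSmoothField.jacobi (hX : IsSmoothField X) (hY : IsSmoothField Y) (hZ : IsSmoothField Z)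
    (x : M) :
    VectorField.mlieBracket I X (VectorField.mlieBracket I Y Z) x
      = VectorField.mlieBracket I (VectorField.mlieBracket I X Y) Z x
        + VectorField.mlieBracket I Y (VectorField.mlieBracket I X Z) x := by
  have : IsManifold I (minSmoothness ℝ 3) M := by
    rw [minSmoothness_of_isRCLikeNormedField]
    exact IsManifold.of_le (n := ∞) (by exact ENat.LEInfty.out)
  have h2 : minSmoothness ℝ 2 ≤ ∞ := by
    rw [minSmoothness_of_isRCLikeNormedField]
    exact ENat.LEInfty.out
  exact leibniz_identity_mlieBracket_apply ((hX x).of_le h2) ((hY x).of_le h2) ((hZ x).of_le h2)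

/-- `[X, Y] f = X (Y f) - Y (X f)`. -/
theorem mvfderiv_mlieBracket [T2Space M] (hX : IsSmoothField X) (hY : IsSmoothField Y)
    (hf : CMDiff ∞ f) (hXf : MDiffAt (fun y ↦ d% f y (X y)) x)
    (hYf : MDiffAt (fun y ↦ d% f y (Y y)) x) :
    d% f x (mlieBracket I X Y x)
      = d% (fun y ↦ d% f y (Y y)) x (X x) - d% (fun y ↦ d% f y (X y)) x (Y x) := by
  rcases subsingleton_or_nontrivial (TangentSpace I x) with _ | _
  · rw [Subsingleton.elim (X x) 0, Subsingleton.elim (Y x) 0,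
      Subsingleton.elim (mlieBracket I X Y x) 0]
    simp
  obtain ⟨v, hv⟩ := exists_ne (0 : TangentSpace I x)
  -- The Jacobi identity for $X$, $Y$, $fZ$, with $Z$ nonzero at `x`, contains the claim as the
  -- coefficient of $Z$: the terms with $f$ undifferentiated cancel by Jacobi for $X,Y,Z$, and the
  -- terms $(Xf)[Y,Z]$, $(Yf)[X,Z]$ occur on both sides.
  set Z := smoothExtend v with hZ_def
  have hZ : IsSmoothField Z := isSmoothField_smoothExtend v
  have hZx : Z x = v := smoothExtend_self v
  have hfd : ∀ y, MDiffAt f y := fun y ↦ (hf y).mdifferentiableAt (by simp)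
  have hbr : ∀ V : Π x : M, TangentSpace I x, mlieBracket I V (f • Z)
      = (fun y ↦ d% f y (V y)) • Z + f • mlieBracket I V Z := fun V ↦ by
    funext y
    exact mlieBracket_smul_right (hfd y) (hZ.mdifferentiableAt y)
  have hbr2 : ∀ V U : Π x : M, TangentSpace I x, IsSmoothField V →
      MDiffAt (fun y ↦ d% f y (V y)) x → mlieBracket I U (mlieBracket I V (f • Z)) x
        = d% (fun y ↦ d% f y (V y)) x (U x) • Z x + d% f x (V x) • mlieBracket I U Z x
          + (d% f x (U x) • mlieBracket I V Z x
            + f x • mlieBracket I U (mlieBracket I V Z) x) := by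
    intro V U hV hVf
    have hVZ := (hV.mlieBracket hZ).mdifferentiableAt x
    rw [hbr, mlieBracket_add_right (hVf.smul_section (hZ.mdifferentiableAt x))
      ((hfd x).smul_section hVZ), mlieBracket_smul_right hVf (hZ.mdifferentiableAt x),
      mlieBracket_smul_right (hfd x) hVZ]
  have hJ := hX.jacobi hY (hZ.smul hf) x
  rw [hbr2 Y X hY hYf, hbr2 X Y hX hXf, hbr, hX.jacobi hY hZ x] at hJ
  simp only [Pi.add_apply, Pi.smul_apply', hZx] at hJ
  have h0 : (d% f x (mlieBracket I X Y x) - (d% (fun y ↦ d% f y (Y y)) x (X x)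
      - d% (fun y ↦ d% f y (X y)) x (Y x))) • v = 0 := by
    have := sub_eq_zero.2 hJ.symm
    rw [← this]
    module
  exact sub_eq_zero.1 ((smul_eq_zero.1 h0).resolve_right hv)

end Fields

/-! ### Curvature of a connection on smooth fields. -/

section Connection

variable {E : Type*} [NormedAddCommGroup E] [NormedSpace ℝ E]
  {H : Type*} [TopologicalSpace H] {I : ModelWithCorners ℝ E H}
  {M : Type*} [TopologicalSpace M] [ChartedSpace H M] [IsManifold I ∞ M]
  {cov : CovariantDerivative I E (TangentSpace I : M → Type _)}
  {X Y Y' Z Z' : Π x : M, TangentSpace I x} {f : M → ℝ} {x : M}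

theorem cov_add (hY : IsSmoothField Y) (hZ : IsSmoothField Z) (x : M) :
    cov (Y + Z) x = cov Y x + cov Z x :=
  cov.isCovariantDerivativeOnUniv.add (hY.mdifferentiableAt x) (hZ.mdifferentiableAt x)

theorem cov_smul (hf : CMDiff ∞ f) (hY : IsSmoothField Y) (x : M) :
    cov (f • Y) x = f x • cov Y x + (d% f x).smulRight (Y x) :=
  cov.isCovariantDerivativeOnUniv.leibniz (hY.mdifferentiableAt x)
    ((hf x).mdifferentiableAt (by simp))

theorem cov_const_smul (c : ℝ) (hY : IsSmoothField Y) (x : M) :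
    cov (c • Y) x = c • cov Y x :=
  cov.isCovariantDerivativeOnUniv.smul_const c (hY.mdifferentiableAt x)

theorem cov_sub (hY : IsSmoothField Y) (hZ : IsSmoothField Z) (x : M) :
    cov (Y - Z) x = cov Y x - cov Z x := by
  have h := cov_add (cov := cov) (hY.sub hZ) hZ x
  rw [sub_add_cancel] at h
  rw [h, add_sub_cancel_right]

theorem curvatureOfFields_antisymm (X Y Z : Π x : M, TangentSpace I x) (x : M) :
    curvatureOfFields cov X Y Z x = - curvatureOfFields cov Y X Z x := by
  rw [curvatureOfFields, curvatureOfFields, mlieBracket_swap_apply, map_neg]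
  abel

theorem curvatureOfFields_add_right (hcov : PreservesSmooth cov) (hX : IsSmoothField X)
    (hY : IsSmoothField Y) (hZ : IsSmoothField Z) (hZ' : IsSmoothField Z') (x : M) :
    curvatureOfFields cov X Y (Z + Z') x
      = curvatureOfFields cov X Y Z x + curvatureOfFields cov X Y Z' x := by
  have h : ∀ V : Π x : M, TangentSpace I x, (fun y ↦ cov (Z + Z') y (V y))
      = (fun y ↦ cov Z y (V y)) + fun y ↦ cov Z' y (V y) := fun V ↦ by
    funext y
    rw [cov_add hZ hZ']
    rfl
  rw [curvatureOfFields, h, h, cov_add (hcov hY hZ) (hcov hY hZ'),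
    cov_add (hcov hX hZ) (hcov hX hZ'), cov_add hZ hZ', curvatureOfFields, curvatureOfFields]
  simp only [add_apply]
  abel

variable [FiniteDimensional ℝ E]

theorem curvatureOfFields_add_mid (hcov : PreservesSmooth cov)
    (hY : IsSmoothField Y) (hY' : IsSmoothField Y') (hZ : IsSmoothField Z) (x : M) :
    curvatureOfFields cov X (Y + Y') Z x
      = curvatureOfFields cov X Y Z x + curvatureOfFields cov X Y' Z x := by
  have h : (fun y ↦ cov Z y ((Y + Y') y))
      = (fun y ↦ cov Z y (Y y)) + fun y ↦ cov Z y (Y' y) := by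
    funext y
    exact map_add (cov Z y) _ _
  rw [curvatureOfFields, h, cov_add (hcov hY hZ) (hcov hY' hZ),
    mlieBracket_add_right (hY.mdifferentiableAt x) (hY'.mdifferentiableAt x),
    curvatureOfFields, curvatureOfFields]
  simp only [add_apply, Pi.add_apply, map_add]
  abel

theorem curvatureOfFields_smul_mid (hcov : PreservesSmooth cov) (c : ℝ)
    (hY : IsSmoothField Y) (hZ : IsSmoothField Z) (x : M) :
    curvatureOfFields cov X (c • Y) Z x = c • curvatureOfFields cov X Y Z x := by
  have h : (fun y ↦ cov Z y ((c • Y) y)) = c • fun y ↦ cov Z y (Y y) := by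
    funext y
    exact map_smul (cov Z y) _ _
  rw [curvatureOfFields, h, cov_const_smul c (hcov hY hZ),
    mlieBracket_const_smul_right (hY.mdifferentiableAt x), curvatureOfFields]
  simp only [smul_apply, Pi.smul_apply, map_smul, smul_sub]

/-- The first Bianchi identity. -/
theorem curvatureOfFields_bianchi (hcov : PreservesSmooth cov) (h_torsion : cov.torsion = 0)
    (hX : IsSmoothField X) (hY : IsSmoothField Y) (hZ : IsSmoothField Z) (x : M) :
    curvatureOfFields cov X Y Z x + curvatureOfFields cov Y Z X x
      + curvatureOfFields cov Z X Y x = 0 := by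
  have hT : ∀ {U V : Π x : M, TangentSpace I x}, IsSmoothField U → IsSmoothField V → ∀ y,
      cov V y (U y) - cov U y (V y) = mlieBracket I U V y := fun hU hV y ↦
    cov.torsion_eq_zero_iff.1 h_torsion (hU.mdifferentiableAt y) (hV.mdifferentiableAt y)
  -- Using zero torsion twice turns this combination into a double bracket; its cyclic sum is the
  -- Bianchi sum, so Jacobi concludes.
  have hD : ∀ {T U V : Π x : M, TangentSpace I x}, IsSmoothField T → IsSmoothField U →
      IsSmoothField V → cov (fun y ↦ cov V y (U y)) x (T x) - cov (fun y ↦ cov U y (V y)) x (T x)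
        - cov T x (mlieBracket I U V x) = mlieBracket I T (mlieBracket I U V) x := by
    intro T U V hT' hU hV
    rw [← hT hT' (hU.mlieBracket hV), ← sub_apply,
      ← cov_sub (hcov hU hV) (hcov hV hU),
      show (fun y ↦ cov V y (U y)) - (fun y ↦ cov U y (V y)) = mlieBracket I U V from
        funext fun y ↦ hT hU hV y]
  have h1 := hD hX hY hZ
  have h2 := hD hY hZ hX
  have h3 := hD hZ hX hY
  have hJ := hX.jacobi hY hZ x
  have hs : mlieBracket I (mlieBracket I X Y) Z x = - mlieBracket I Z (mlieBracket I X Y) x :=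
    mlieBracket_swap_apply
  have hs' : mlieBracket I Y (mlieBracket I X Z) x = - mlieBracket I Y (mlieBracket I Z X) x := by
    rw [mlieBracket_swap (V := X) (W := Z), ← neg_one_smul ℝ (mlieBracket I Z X),
      mlieBracket_const_smul_right ((hZ.mlieBracket hX).mdifferentiableAt x), neg_one_smul]
  rw [hs, hs', ← h1, ← h2, ← h3] at hJ
  rw [← sub_eq_zero] at hJ
  rw [← hJ]
  simp only [curvatureOfFields]
  abel

/-- The curvature tensor can be computed with the globally smooth extensions of the tangent
vectors. -/
theorem curvature_eq_curvatureOfFields [T2Space M] (hcov : PreservesSmooth cov)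
    (u v w : TangentSpace I x) :
    curvature cov x u v w
      = curvatureOfFields cov (smoothExtend u) (smoothExtend v) (smoothExtend w) x := by
  have hu := smoothExtend_eventuallyEq u
  have hv := smoothExtend_eventuallyEq v
  have hw := smoothExtend_eventuallyEq w
  have h_congr : ∀ {σ σ' : Π x : M, TangentSpace I x} {y : M}, IsSmoothField σ →
      (∀ᶠ z in nhds y, σ z = σ' z) → cov σ' y = cov σ y := by
    intro σ σ' y hσ h
    refine (cov.isCovariantDerivativeOnUniv.congr_of_eventuallyEq (hσ.mdifferentiableAt y) ?_
      Filter.univ_mem h).symm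
    refine (hσ.mdifferentiableAt y).congr_of_eventuallyEq ?_
    filter_upwards [h] with z hz
    rw [hz]
  -- The third field is differentiated twice, so its first derivatives must agree near `x`, not only
  -- at `x`.
  have hw' : ∀ᶠ y in nhds x, cov (FiberBundle.extend E w) y = cov (smoothExtend w) y := by
    filter_upwards [hw.eventually_nhds] with y hy
    exact h_congr (isSmoothField_smoothExtend w) hy
  have h2 : ∀ {a : TangentSpace I x}, cov (fun y ↦ cov (FiberBundle.extend E w) y
      (FiberBundle.extend E a y)) x
        = cov (fun y ↦ cov (smoothExtend w) y (smoothExtend a y)) x := by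
    intro a
    refine h_congr (hcov (isSmoothField_smoothExtend a) (isSmoothField_smoothExtend w)) ?_
    filter_upwards [hw', smoothExtend_eventuallyEq a] with y hy hy'
    rw [hy, hy']
  rw [curvature, curvatureOfFields, curvatureOfFields, h2, h2, hw'.self_of_nhds,
    hu.self_of_nhds, hv.self_of_nhds, Filter.EventuallyEq.mlieBracket_vectorField_eq hu hv]

end Connection

/-! ### The Levi-Civita connection: skewness of $R(X,Y)$. -/

section LeviCivita

variable {E : Type*} [NormedAddCommGroup E] [NormedSpace ℝ E]
  {H : Type*} [TopologicalSpace H] {I : ModelWithCorners ℝ E H}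
  {M : Type*} [TopologicalSpace M] [ChartedSpace H M] [IsManifold I ∞ M]
  {g : ContMDiffRiemannianMetric I ∞ E (TangentSpace I : M → Type _)}
  {cov : CovariantDerivative I E (TangentSpace I : M → Type _)}
  {X Y Z W : Π x : M, TangentSpace I x} {x : M}

theorem contMDiff_metric (hX : IsSmoothField X) (hY : IsSmoothField Y) :
    CMDiff ∞ fun y ↦ g.inner y (X y) (Y y) := by
  intro y
  have h := ContMDiffAt.clm_bundle_apply₂ (F₁ := E) (F₂ := E) (F₃ := ℝ)
    (E₃ := Bundle.Trivial M ℝ) (b := id) (g.contMDiff y) (hX y) (hY y)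
  exact (contMDiffAt_totalSpace.1 h).2

variable [FiniteDimensional ℝ E]

theorem IsLeviCivita.preservesSmooth (h : IsLeviCivita g cov) : PreservesSmooth cov := by
  intro X Y hX hY
  have h1 := h.smooth.contMDiff.contMDiff (σ := Y) (ContMDiff.contMDiffOn (by simpa using! hY))
  rw [contMDiffOn_univ] at h1
  exact ContMDiff.clm_bundle_apply (b := id) h1 hX

theorem IsLeviCivita.torsion_apply (h : IsLeviCivita g cov) (hX : IsSmoothField X)
    (hY : IsSmoothField Y) (y : M) : mlieBracket I X Y y = cov Y y (X y) - cov X y (Y y) :=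
  (cov.torsion_eq_zero_iff.1 h.torsion_eq_zero (hX.mdifferentiableAt y)
    (hY.mdifferentiableAt y)).symm

theorem IsLeviCivita.mvfderiv_metric (h : IsLeviCivita g cov) (hX : IsSmoothField X)
    (hY : IsSmoothField Y) (y : M) (u : TangentSpace I y) :
    d% (fun z ↦ g.inner z (X z) (Y z)) y u
      = g.inner y (cov X y u) (Y y) + g.inner y (X y) (cov Y y u) :=
  h.metric y u X Y (hX.mdifferentiableAt y) (hY.mdifferentiableAt y)

/-- The endomorphisms `R(X, Y)` are skew. -/
theorem IsLeviCivita.curvatureOfFields_skew [T2Space M] (h : IsLeviCivita g cov)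
    (hX : IsSmoothField X) (hY : IsSmoothField Y) (hZ : IsSmoothField Z) (hW : IsSmoothField W)
    (x : M) :
    g.inner x (curvatureOfFields cov X Y Z x) (W x)
      = - g.inner x (Z x) (curvatureOfFields cov X Y W x) := by
  have hcov := h.preservesSmooth
  have hd : ∀ V : Π x : M, TangentSpace I x, (fun y ↦ d% (fun z ↦ g.inner z (Z z) (W z)) y (V y))
      = (fun y ↦ g.inner y (cov Z y (V y)) (W y)) + fun y ↦ g.inner y (Z y) (cov W y (V y)) :=
    fun V ↦ funext fun y ↦ h.mvfderiv_metric hZ hW y (V y)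
  have hdiff : ∀ {U V : Π x : M, TangentSpace I x}, IsSmoothField U → IsSmoothField V →
      MDiffAt (fun y ↦ g.inner y (U y) (V y)) x := fun hU hV ↦
    (contMDiff_metric hU hV x).mdifferentiableAt (by simp)
  have hdd : ∀ {V : Π x : M, TangentSpace I x}, IsSmoothField V →
      MDiffAt (fun y ↦ d% (fun z ↦ g.inner z (Z z) (W z)) y (V y)) x := fun hV ↦ by
    rw [hd]
    exact (hdiff (hcov hV hZ) hW).add (hdiff hZ (hcov hV hW))
  -- The two mixed terms are exchanged by swapping $U$ and $V$, so they drop out of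
  -- $[X,Y]g(Z,W)=X(Yg(Z,W))-Y(Xg(Z,W))$.
  have h2 : ∀ {U V : Π x : M, TangentSpace I x}, IsSmoothField V →
      d% (fun y ↦ d% (fun z ↦ g.inner z (Z z) (W z)) y (V y)) x (U x)
        = (g.inner x (cov (fun y ↦ cov Z y (V y)) x (U x)) (W x)
            + g.inner x (cov Z x (V x)) (cov W x (U x)))
          + (g.inner x (cov Z x (U x)) (cov W x (V x))
            + g.inner x (Z x) (cov (fun y ↦ cov W y (V y)) x (U x))) := fun hV ↦ by
    rw [hd, mvfderiv_add (hdiff (hcov hV hZ) hW) (hdiff hZ (hcov hV hW)),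
      add_apply, h.mvfderiv_metric (hcov hV hZ) hW,
      h.mvfderiv_metric hZ (hcov hV hW)]
  have hb := mvfderiv_mlieBracket hX hY (contMDiff_metric hZ hW) (hdd hX) (hdd hY)
  rw [h2 hY, h2 hX, h.mvfderiv_metric hZ hW] at hb
  simp only [curvatureOfFields, map_sub, sub_apply]
  linarith

end LeviCivita

/-! ### Kenmotsu structures and the curvature of $\tilde\nabla$. -/

section KenmotsuManifold

variable {E : Type*} [NormedAddCommGroup E] [NormedSpace ℝ E]
  {H : Type*} [TopologicalSpace H] {I : ModelWithCorners ℝ E H}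
  {M : Type*} [TopologicalSpace M] [ChartedSpace H M] [IsManifold I ∞ M]
  {g : ContMDiffRiemannianMetric I ∞ E (TangentSpace I : M → Type _)}
  {cov : CovariantDerivative I E (TangentSpace I : M → Type _)}
  {s : AlmostContactMetricStructure g}
  {X Y Z W : Π x : M, TangentSpace I x} {x : M}

/-- `η` is the `1`-form dual to `ξ`. -/
theorem AlmostContactMetricStructure.η_eq (s : AlmostContactMetricStructure g)
    (u : TangentSpace I x) : s.η x u = g.inner x u (s.ξ x) := by
  have hξ : s.ξ x ≠ 0 := fun h ↦ by simpa [h] using s.η_ξ x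
  have h1 : s.φ x (s.φ x (s.ξ x)) = 0 := by rw [s.φ_sq, s.η_ξ, one_smul, neg_add_cancel]
  -- Computing $\phi^3\xi$ in two ways gives $\phi\xi=c\,\xi$; then $c^2\xi=\phi^2\xi=0$, so
  -- $\phi\xi=0$, and compatibility with $\xi$ gives the duality.
  have h2 : s.φ x (s.ξ x) = s.η x (s.φ x (s.ξ x)) • s.ξ x := by
    have := s.φ_sq x (s.φ x (s.ξ x))
    rw [h1, map_zero] at this
    exact (neg_add_eq_zero.1 this.symm)
  set c := s.η x (s.φ x (s.ξ x))
  have h3 : s.φ x (s.ξ x) = 0 := by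
    rw [h2, map_smul, h2, smul_smul] at h1
    have := mul_self_eq_zero.1 ((smul_eq_zero.1 h1).resolve_right hξ)
    rw [h2, this, zero_smul]
  have h4 := s.compatible x u (s.ξ x)
  rw [h3, map_zero, s.η_ξ, mul_one] at h4
  linarith

theorem AlmostContactMetricStructure.isSmoothField_ξ (s : AlmostContactMetricStructure g) :
    IsSmoothField s.ξ := s.smooth_ξ

theorem AlmostContactMetricStructure.metric_ξ_ξ (s : AlmostContactMetricStructure g) (x : M) :
    g.inner x (s.ξ x) (s.ξ x) = 1 := by
  rw [← s.η_eq, s.η_ξ]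

theorem IsKenmotsu.cov_ξ (hs : IsKenmotsu s cov) (u : TangentSpace I x) :
    cov s.ξ x u = u - g.inner x u (s.ξ x) • s.ξ x := by
  rw [hs x u, s.η_eq]

theorem tildeConnection_eq (s : AlmostContactMetricStructure g)
    (X Y : Π x : M, TangentSpace I x) :
    (fun y ↦ tildeConnection s cov Y y (X y))
      = (fun y ↦ cov Y y (X y)) - (fun y ↦ g.inner y (Y y) (s.ξ y)) • X
        - (fun y ↦ g.inner y (X y) (Y y)) • s.ξ := by
  funext y
  rw [tildeConnection_apply, s.η_eq]
  rfl

theorem PreservesSmooth.tildeConnection (hcov : PreservesSmooth cov)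
    (s : AlmostContactMetricStructure g) : PreservesSmooth (tildeConnection s cov) := by
  intro X Y hX hY
  rw [tildeConnection_eq]
  exact ((hcov hX hY).sub (hX.smul (contMDiff_metric hY s.isSmoothField_ξ))).sub
    (s.isSmoothField_ξ.smul (contMDiff_metric hX hY))

/-- The metric at a point, as a bilinear map. -/
noncomputable def metricLinear (g : ContMDiffRiemannianMetric I ∞ E (TangentSpace I : M → Type _))
    (x : M) : TangentSpace I x →ₗ[ℝ] TangentSpace I x →ₗ[ℝ] ℝ :=
  ContinuousLinearMap.coeLM ℝ ∘ₗ (g.inner x).toLinearMap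

theorem metricAt_eq_metricLinear (x : M) :
    metricAt g x = fun u v ↦ metricLinear g x u v := rfl

theorem metricLinear_symm (u v : TangentSpace I x) :
    metricLinear g x u v = metricLinear g x v u := g.symm x u v

theorem metricLinear_pos (u : TangentSpace I x) (hu : u ≠ 0) : 0 < metricLinear g x u u :=
  g.pos x u hu

variable [FiniteDimensional ℝ E]

/-- `R(X, Y)ξ = η(X)Y - η(Y)X` on a Kenmotsu manifold. -/
theorem curvatureOfFields_ξ (h : IsLeviCivita g cov) (hs : IsKenmotsu s cov)
    (hX : IsSmoothField X) (hY : IsSmoothField Y) (x : M) :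
    curvatureOfFields cov X Y s.ξ x
      = g.inner x (X x) (s.ξ x) • Y x - g.inner x (Y x) (s.ξ x) • X x := by
  have hξ := s.isSmoothField_ξ
  have h1 : ∀ V : Π x : M, TangentSpace I x, (fun y ↦ cov s.ξ y (V y))
      = V - (fun y ↦ g.inner y (V y) (s.ξ y)) • s.ξ := fun V ↦ funext fun y ↦ hs.cov_ξ (V y)
  -- This is $\nabla_U(V-\eta(V)\xi)$. On antisymmetrizing, the terms symmetric in $U,V$ cancel and
  -- zero torsion absorbs $\nabla_{[X,Y]}\xi$.
  have h2 : ∀ {U V : Π x : M, TangentSpace I x}, IsSmoothField V →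
      cov (fun y ↦ cov s.ξ y (V y)) x (U x) = cov V x (U x)
        - (g.inner x (V x) (s.ξ x) • (U x - g.inner x (U x) (s.ξ x) • s.ξ x)
          + (g.inner x (cov V x (U x)) (s.ξ x) + g.inner x (V x) (U x)
            - g.inner x (U x) (s.ξ x) * g.inner x (V x) (s.ξ x)) • s.ξ x) := by
    intro U V hV
    rw [h1, cov_sub hV (hξ.smul (contMDiff_metric hV hξ)), cov_smul (contMDiff_metric hV hξ) hξ]
    simp only [sub_apply, add_apply, smul_apply, ContinuousLinearMap.smulRight_apply,
      h.mvfderiv_metric hV hξ, hs.cov_ξ, map_sub, map_smul, smul_eq_mul]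
    module
  rw [curvatureOfFields, h2 hY, h2 hX, hs.cov_ξ, h.torsion_apply hX hY]
  simp only [map_sub, sub_apply, g.symm x (Y x) (X x)]
  module

/-- The curvature of the connection `∇̃`. -/
theorem curvatureOfFields_tildeConnection (h : IsLeviCivita g cov) (hs : IsKenmotsu s cov)
    (hX : IsSmoothField X) (hY : IsSmoothField Y) (hZ : IsSmoothField Z) (x : M) :
    curvatureOfFields (tildeConnection s cov) X Y Z x
      = curvatureOfFields cov X Y Z x + wedge (metricAt g x) (X x) (Y x) (Z x)
        + (2 * (g.inner x (Y x) (Z x) * g.inner x (X x) (s.ξ x)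
          - g.inner x (X x) (Z x) * g.inner x (Y x) (s.ξ x))) • s.ξ x := by
  have hξ := s.isSmoothField_ξ
  have hcov := h.preservesSmooth
  have h2 : ∀ {U V : Π x : M, TangentSpace I x}, IsSmoothField U → IsSmoothField V →
      cov (fun y ↦ tildeConnection s cov Z y (V y)) x (U x)
        = cov (fun y ↦ cov Z y (V y)) x (U x)
          - (g.inner x (Z x) (s.ξ x) • cov V x (U x)
            + (g.inner x (cov Z x (U x)) (s.ξ x) + g.inner x (Z x) (U x)
              - g.inner x (U x) (s.ξ x) * g.inner x (Z x) (s.ξ x)) • V x)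
          - (g.inner x (V x) (Z x) • (U x - g.inner x (U x) (s.ξ x) • s.ξ x)
            + (g.inner x (cov V x (U x)) (Z x) + g.inner x (V x) (cov Z x (U x))) • s.ξ x) := by
    intro U V hU hV
    have ha := contMDiff_metric (g := g) hZ hξ
    have hb := contMDiff_metric (g := g) hV hZ
    rw [tildeConnection_eq, cov_sub ((hcov hV hZ).sub (hV.smul ha)) (hξ.smul hb),
      cov_sub (hcov hV hZ) (hV.smul ha), cov_smul ha hV, cov_smul hb hξ]
    simp only [sub_apply, add_apply, smul_apply, ContinuousLinearMap.smulRight_apply,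
      h.mvfderiv_metric hZ hξ, h.mvfderiv_metric hV hZ, hs.cov_ξ, map_sub, map_smul, smul_eq_mul]
    module
  rw [curvatureOfFields, tildeConnection_apply, tildeConnection_apply, tildeConnection_apply,
    h2 hX hY, h2 hY hX, h.torsion_apply hX hY, curvatureOfFields, h.torsion_apply hX hY]
  simp only [tildeConnection_apply, wedge, metricAt, s.η_eq, map_sub, map_smul, sub_apply,
    smul_apply, smul_eq_mul, s.metric_ξ_ξ]
  rw [g.symm x (Y x) (X x), g.symm x (Z x) (X x), g.symm x (Z x) (Y x)]
  module

variable [T2Space M]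

theorem IsLeviCivita.isCurvatureLike (h : IsLeviCivita g cov) (x : M) :
    IsCurvatureLike (metricLinear g x) (curvature cov x) where
  add_mid u v v' w := by
    simp only [curvature_eq_curvatureOfFields h.preservesSmooth, smoothExtend_add]
    exact curvatureOfFields_add_mid h.preservesSmooth (isSmoothField_smoothExtend v)
      (isSmoothField_smoothExtend v') (isSmoothField_smoothExtend w) x
  smul_mid c u v w := by
    simp only [curvature_eq_curvatureOfFields h.preservesSmooth, smoothExtend_smul]
    exact curvatureOfFields_smul_mid h.preservesSmooth c (isSmoothField_smoothExtend v)
      (isSmoothField_smoothExtend w) x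
  add_right u v w w' := by
    simp only [curvature_eq_curvatureOfFields h.preservesSmooth, smoothExtend_add]
    exact curvatureOfFields_add_right h.preservesSmooth (isSmoothField_smoothExtend u)
      (isSmoothField_smoothExtend v) (isSmoothField_smoothExtend w)
      (isSmoothField_smoothExtend w') x
  antisymm u v w := curvatureOfFields_antisymm _ _ _ x
  skew u v w z := by
    have := h.curvatureOfFields_skew (isSmoothField_smoothExtend u) (isSmoothField_smoothExtend v)
      (isSmoothField_smoothExtend w) (isSmoothField_smoothExtend z) x
    rw [smoothExtend_self, smoothExtend_self] at this
    rw [curvature_eq_curvatureOfFields h.preservesSmooth,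
      curvature_eq_curvatureOfFields h.preservesSmooth]
    exact this
  bianchi u v w := by
    simp only [curvature_eq_curvatureOfFields h.preservesSmooth]
    exact curvatureOfFields_bianchi h.preservesSmooth h.torsion_eq_zero
      (isSmoothField_smoothExtend u) (isSmoothField_smoothExtend v)
      (isSmoothField_smoothExtend w) x

/-- `curvature` extends the vector $\xi_x$ by a field other than $\xi$. Skewness shows that the
choice does not matter: $g(R(u,v)\xi,w)=-g(\xi,R(u,v)w)$ involves $\xi$ only through its value at
`x`. -/
theorem curvature_ξ (h : IsLeviCivita g cov) (hs : IsKenmotsu s cov) (u v : TangentSpace I x) :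
    curvature cov x u v (s.ξ x)
      = metricLinear g x u (s.ξ x) • v - metricLinear g x v (s.ξ x) • u := by
  have hu := isSmoothField_smoothExtend u
  have hv := isSmoothField_smoothExtend v
  have hξ := s.isSmoothField_ξ
  have h1 := curvatureOfFields_ξ h hs hu hv x
  rw [smoothExtend_self, smoothExtend_self] at h1
  refine (eq_of_forall_metric_eq (metricLinear_pos (g := g)) fun w ↦ ?_).trans h1
  have hw := isSmoothField_smoothExtend w
  have h2 := h.curvatureOfFields_skew hu hv hξ hw x
  have h3 := h.curvatureOfFields_skew hu hv (isSmoothField_smoothExtend (s.ξ x)) hw x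
  rw [smoothExtend_self] at h2
  rw [smoothExtend_self, smoothExtend_self] at h3
  rw [curvature_eq_curvatureOfFields h.preservesSmooth]
  exact h3.trans h2.symm

theorem curvature_tildeConnection (h : IsLeviCivita g cov) (hs : IsKenmotsu s cov)
    (u v w : TangentSpace I x) :
    curvature (tildeConnection s cov) x u v w
      = curvature cov x u v w + wedge (fun a b ↦ metricLinear g x a b) u v w
        + (2 * (metricLinear g x v w * metricLinear g x u (s.ξ x)
          - metricLinear g x u w * metricLinear g x v (s.ξ x))) • s.ξ x := by
  rw [curvature_eq_curvatureOfFields (h.preservesSmooth.tildeConnection s),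
    curvature_eq_curvatureOfFields h.preservesSmooth]
  have := curvatureOfFields_tildeConnection h hs (isSmoothField_smoothExtend u)
    (isSmoothField_smoothExtend v) (isSmoothField_smoothExtend w) x
  rw [smoothExtend_self, smoothExtend_self, smoothExtend_self] at this
  exact this

end KenmotsuManifold

end KenmotsuGeometry

/-! ### The main theorem. -/

theorem mainTheorem4 (n : ℕ) (hn : 1 ≤ n)
    {M : Type*} [TopologicalSpace M] [T2Space M]
    [ChartedSpace (EuclideanSpace ℝ (Fin (2 * n + 1))) M] [IsManifold (𝓡 (2 * n + 1)) ∞ M]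
    (g : ContMDiffRiemannianMetric (𝓡 (2 * n + 1)) ∞ (EuclideanSpace ℝ (Fin (2 * n + 1)))
      (TangentSpace (𝓡 (2 * n + 1)) : M → Type _))
    (nabla : CovariantDerivative (𝓡 (2 * n + 1)) (EuclideanSpace ℝ (Fin (2 * n + 1)))
      (TangentSpace (𝓡 (2 * n + 1)) : M → Type _))
    (h_nabla : IsLeviCivita g nabla)
    (s : AlmostContactMetricStructure g) (hs : IsKenmotsu s nabla)
    (h_ricci : ∀ x : M,
      dotTwo (curvature (tildeConnection s nabla) x) (ricci (curvature (tildeConnection s nabla) x))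
        = dotTwo (curvature nabla x) (ricci (curvature nabla x)))
    (x : M) :
    dotFour (conformalCurvature g nabla x) (lower (metricAt g x) (curvature nabla x))
          - dotFour (curvature nabla x) (lower (metricAt g x) (conformalCurvature g nabla x))
        = tachibana (metricAt g x) (lower (metricAt g x) (curvature nabla x))
      ∧ tachibana (metricAt g x) (lower (metricAt g x) (curvature nabla x))
        = tachibana (metricAt g x) (lower (metricAt g x) (conformalCurvature g nabla x)) := by
  have hR := h_nabla.isCurvatureLike x
  have hN : finrank ℝ (TangentSpace (𝓡 (2 * n + 1)) x) = 2 * n + 1 :=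
    finrank_euclideanSpace_fin (𝕜 := ℝ)
  have hξ : metricLinear g x (s.ξ x) (s.ξ x) = 1 := s.metric_ξ_ξ x
  have hS := ricci_eq_of_dotTwo_eq hR metricLinear_symm metricLinear_pos hξ
    (curvature_ξ h_nabla hs) (curvature_tildeConnection h_nabla hs) (h_ricci x)
  rw [conformalCurvature, metricAt_eq_metricLinear]
  exact dotFour_sub_dotFour_of_eq_add_wedge hR metricLinear_symm
    -- Since $n\ge1$, the dimension is at least $3$ and $N-2\ne0$.
    (conformal_eq_add_wedge metricLinear_symm metricLinear_pos (by omega) hS)
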